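/- Let $\mathbf k$ be a field, let $Q=(Q_0,Q_1,s,t)$ be a finite quiver without oriented cycles, and let $\mathbf kQ$ be its path algebra. Write $(\mathbf kQ)_{>0}$ for the span of the paths of positive length and $(\mathbf kQ)_{\ge 2}$ for the two-sided ideal generated by the paths of length two. Let $G$ be either the torus $\mathbb G_m^{Q_0}$ or its quotient $\mathrm{PGL}(Q;\mathbf 1)=\mathbb G_m^{Q_0}/\mathbb G_m$ by the small diagonal, acting on $\mathbb A^{Q_1}$ by $(g\cdot x)_a=g_{t(a)}\,x_a\,g_{s(a)}^{-1}$, and let $\mathcal M(Q;\mathbf 1)=[\mathbb A^{Q_1}/G]$ be the moduli stack of representations of $Q$ of dimension vector $\mathbf 1=(1,\dots,1)$. For a two-sided ideal $I\subset\mathbf kQ$ let $\mathcal M(Q,I;\mathbf 1)\subset\mathcal M(Q;\mathbf 1)$ be the substack of representations that are annihilated by $I$. Theorem. The ideal $I\subset(\mathbf kQ)_{\ge 2}$ of relations is determined by the substack $\mathcal M(Q,I;\mathbf 1)$ of $\mathcal M(Q;\mathbf 1)$: if $I,I'\subset(\mathbf kQ)_{\ge 2}$ are two-sided ideals with $\mathcal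 M(Q,I;\mathbf 1)=\mathcal M(Q,I';\mathbf 1)$, then $I=I'$. More precisely, let $S=\mathbf k[x_a]_{a\in Q_1}$ be graded by $\mathbb Z^{Q_0}$ with $\deg x_a=e_{t(a)}-e_{s(a)}$, let $\phi\colon(\mathbf kQ)_{>0}\to S$ be the linear map that sends a path $a_n\cdots a_1$ to the monomial $x_{a_1}\cdots x_{a_n}$, and let $J\subset S$ be the ideal generated by $\phi(I)$, for a two-sided ideal $I\subset(\mathbf kQ)_{\ge 2}$. Then: 1. $J$ is homogeneous for the $\mathbb Z^{Q_0}$-grading; 2. $\mathcal M(Q,I;\mathbf 1)$ is the closed substack $[V(J)/G]$ of $[\mathbb A^{Q_1}/G]$, that is, an object $(P\to T,\ f\colon P\to\mathbb A^{Q_1})$ of $[\mathbb A^{Q_1}/G]$ lies in $\mathcal M(Q,I;\mathbf 1)$ if and only if $f$ factors through the closed subscheme $V(J)=\operatorname{Spec}(S/J)$; 3. $J$ is determined by $\mathcal M(Q,I;\mathbf 1)$: a polynomial lies in $J$ if and only if its pullback along $f$ vanishes for every object $(P\to T,\ f)$ of $\mathcal M(Q,I;\mathbf 1)$; 4. $I=\phi^{-1}(J)$.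 -/

import Mathlib

open CategoryTheory AlgebraicGeometry Opposite

universe u

noncomputable section

namespace QuiverModuli

/-! ### Quivers, paths and path algebras -/

section Quivers

variable (V : Type u) [Quiver.{u} V]

/-- The set of all arrows of a quiver: an arrow `a = ⟨i, j, _⟩` has source `i` and target `j`. -/
abbrev Arrow : Type u := Σ i j : V, (i ⟶ j)

/-- The set of all paths of a quiver, including a path of length zero at every vertex. -/
abbrev AnyPath : Type u := Σ i j : V, Quiver.Path i j

/-- There is no path of positive length from a vertex to itself. -/
def NoOrientedCycles : Prop := ∀ (i : V) (p : Quiver.Path i i), p.length = 0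

end Quivers

section PathAlgebra

variable (k : Type u) [Field k] (V : Type u) [Quiver.{u} V]

/-- The path algebra `kQ`: the vector space with basis the set of paths. -/
def PathAlgebra : Type u := AnyPath V →₀ k

namespace PathAlgebra

instance : AddCommGroup (PathAlgebra k V) := inferInstanceAs (AddCommGroup (AnyPath V →₀ k))

instance : Module k (PathAlgebra k V) := inferInstanceAs (Module k (AnyPath V →₀ k))

variable {V}

/-- The basis element given by a path. -/
def ofPath {i j : V} (p : Quiver.Path i j) : PathAlgebra k V :=
  (Finsupp.single (⟨i, j, p⟩ : AnyPath V) (1 : k) : AnyPath V →₀ k)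

/-- The linear map with prescribed values on the basis of paths. -/
def lift {M : Type*} [AddCommGroup M] [Module k M] (F : AnyPath V → M) : PathAlgebra k V →ₗ[k] M :=
  (Finsupp.linearCombination k F : (AnyPath V →₀ k) →ₗ[k] M)

variable {k}

@[simp] theorem lift_ofPath {M : Type*} [AddCommGroup M] [Module k M] (F : AnyPath V → M)
    {i j : V} (p : Quiver.Path i j) : lift k F (ofPath k p) = F ⟨i, j, p⟩ := by
  change Finsupp.linearCombination k F (Finsupp.single _ 1) = _
  simp

theorem hom_ext {M : Type*} [AddCommGroup M] [Module k M] {F G : PathAlgebra k V →ₗ[k] M}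
    (h : ∀ {i j : V} (p : Quiver.Path i j), F (ofPath k p) = G (ofPath k p)) : F = G :=
  Finsupp.lhom_ext' fun a : AnyPath V => LinearMap.ext_ring (h a.2.2)

theorem induction {P : PathAlgebra k V → Prop} (x : PathAlgebra k V) (h0 : P 0)
    (hadd : ∀ y z, P y → P z → P (y + z))
    (hpath : ∀ (c : k) {i j : V} (p : Quiver.Path i j), P (c • ofPath k p)) : P x := by
  refine Finsupp.induction_linear (motive := P) x h0 hadd fun a c => ?_
  have h : (Finsupp.single a c : AnyPath V →₀ k) = c • Finsupp.single a 1 := by simp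
  rw [h]
  exact hpath c a.2.2

variable [DecidableEq V]

variable (k) in
/-- The product of two paths: for `q` and `p` this is the path "first `p`, then `q`" when `p` ends
where `q` starts, and zero otherwise. -/
def pathMul (q p : AnyPath V) : PathAlgebra k V :=
  if h : p.2.1 = q.1 then ofPath k (p.2.2.comp (q.2.2.cast h.symm rfl)) else 0

variable (k V) in
/-- The multiplication of the path algebra as a bilinear map. -/
def mulMap : PathAlgebra k V →ₗ[k] PathAlgebra k V →ₗ[k] PathAlgebra k V :=
  lift k fun q => lift k fun p => pathMul k q p

instance : Mul (PathAlgebra k V) := ⟨fun x y => mulMap k V x y⟩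

theorem mul_def (x y : PathAlgebra k V) : x * y = mulMap k V x y := rfl

theorem ofPath_mul_ofPath {i j l : V} (q : Quiver.Path j l) (p : Quiver.Path i j) :
    ofPath k q * ofPath k p = ofPath k (p.comp q) := by
  simp [mul_def, mulMap, pathMul]

theorem ofPath_mul_ofPath_of_ne {i j j' l : V} (h : j ≠ j') (q : Quiver.Path j' l)
    (p : Quiver.Path i j) : ofPath k q * ofPath k p = 0 := by
  simp [mul_def, mulMap, pathMul, h]

theorem ofPath_mul_assoc {i j i' j' i'' j'' : V} (r : Quiver.Path i'' j'') (q : Quiver.Path i' j')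
    (p : Quiver.Path i j) :
    ofPath k r * ofPath k q * ofPath k p = ofPath k r * (ofPath k q * ofPath k p) := by
  by_cases h₁ : j' = i''
  · subst h₁
    by_cases h₂ : j = i'
    · subst h₂
      simp [ofPath_mul_ofPath]
    · rw [ofPath_mul_ofPath, ofPath_mul_ofPath_of_ne h₂, ofPath_mul_ofPath_of_ne h₂]
      simp [mul_def]
  · rw [ofPath_mul_ofPath_of_ne h₁]
    by_cases h₂ : j = i'
    · subst h₂
      rw [ofPath_mul_ofPath, ofPath_mul_ofPath_of_ne h₁]
      simp [mul_def]
    · rw [ofPath_mul_ofPath_of_ne h₂]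
      simp [mul_def]

variable [Fintype V]

/-- The unit is the sum of the paths of length zero. -/
instance : One (PathAlgebra k V) := ⟨∑ i : V, ofPath k (Quiver.Path.nil : Quiver.Path i i)⟩

theorem one_def :
    (1 : PathAlgebra k V) = ∑ i : V, ofPath k (Quiver.Path.nil : Quiver.Path i i) := rfl

theorem mulMap_one_left : mulMap k V 1 = LinearMap.id := by
  refine hom_ext fun {i j} p => ?_
  rw [one_def, map_sum, LinearMap.sum_apply, Finset.sum_eq_single j]
  · exact ofPath_mul_ofPath (k := k) (Quiver.Path.nil : Quiver.Path j j) p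
  · intro l _ hl
    exact ofPath_mul_ofPath_of_ne hl.symm _ _
  · exact fun h => absurd (Finset.mem_univ _) h

theorem mulMap_one_right : (mulMap k V).flip 1 = LinearMap.id := by
  refine hom_ext fun {i j} p => ?_
  rw [LinearMap.flip_apply, one_def, map_sum, Finset.sum_eq_single i]
  · have h := ofPath_mul_ofPath (k := k) p (Quiver.Path.nil : Quiver.Path i i)
    rw [Quiver.Path.nil_comp] at h
    exact h
  · intro l _ hl
    exact ofPath_mul_ofPath_of_ne hl p (Quiver.Path.nil : Quiver.Path l l)
  · exact fun h => absurd (Finset.mem_univ _) h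

theorem mulMap_assoc (x y z : PathAlgebra k V) :
    mulMap k V (mulMap k V x y) z = mulMap k V x (mulMap k V y z) := by
  induction x using induction with
  | h0 => simp
  | hadd x x' hx hx' => simp [hx, hx']
  | hpath a r =>
    induction y using induction with
    | h0 => simp
    | hadd y y' hy hy' =>
      simp only [map_add, LinearMap.add_apply, hy, hy']
    | hpath b q =>
      induction z using induction with
      | h0 => simp
      | hadd z z' hz hz' => simp only [map_add, hz, hz']
      | hpath c p =>
        have h := ofPath_mul_assoc (k := k) r q p
        simp only [mul_def] at h
        simp only [map_smul, LinearMap.smul_apply, h]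

instance : Ring (PathAlgebra k V) where
  __ := (inferInstance : AddCommGroup (PathAlgebra k V))
  mul_assoc := mulMap_assoc
  one_mul x := LinearMap.congr_fun mulMap_one_left x
  mul_one x := LinearMap.congr_fun mulMap_one_right x
  left_distrib x y z := (mulMap k V x).map_add y z
  right_distrib x y z := LinearMap.map_add₂ (mulMap k V) x y z
  zero_mul x := LinearMap.map_zero₂ (mulMap k V) x
  mul_zero x := (mulMap k V x).map_zero

instance : Algebra k (PathAlgebra k V) :=
  Algebra.ofModule (fun c x y => LinearMap.map_smul₂ (mulMap k V) c x y)
    (fun c x y => (mulMap k V x).map_smul c y)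

variable (k V)

/-- The two-sided ideal `(kQ)_{≥ 2}` generated by the paths of length two. -/
def lengthTwoIdeal : TwoSidedIdeal (PathAlgebra k V) :=
  TwoSidedIdeal.span {x | ∃ (i j : V) (p : Quiver.Path i j), p.length = 2 ∧ x = ofPath k p}

/-- The subspace `(kQ)_{> 0}` spanned by the paths of positive length. -/
def positivePart : Submodule k (PathAlgebra k V) :=
  Submodule.span k {x | ∃ (i j : V) (p : Quiver.Path i j), 0 < p.length ∧ x = ofPath k p}

/-- The linear map `φ` from `(kQ)_{> 0}` to the polynomial ring in the arrows which sends a path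
`a_n ⋯ a_1` to the monomial `x_{a_1} ⋯ x_{a_n}`. -/
def pathMonomial : positivePart k V →ₗ[k] MvPolynomial (Arrow V) k :=
  (lift k fun p : AnyPath V =>
    p.2.2.weight fun {i j : V} (a : i ⟶ j) =>
      (MvPolynomial.X ⟨i, j, a⟩ : MvPolynomial (Arrow V) k)).domRestrict (positivePart k V)

variable {k V}

/-- The representation of the quiver of dimension vector `(1, …, 1)` over a commutative `k`-algebra
`R` in which the arrow `a` acts by the scalar `x a`, from the summand of its source to the summand
of its target, as an algebra homomorphism from `kQ` to the endomorphisms of `R^V`. -/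
def rep {R : Type*} [CommRing R] [Algebra k R] (x : Arrow V → R) :
    PathAlgebra k V →ₐ[k] Matrix V V R :=
  AlgHom.ofLinearMap
    (lift k fun p : AnyPath V =>
      Matrix.single p.2.1 p.1 (p.2.2.weight fun {i j : V} (a : i ⟶ j) => x ⟨i, j, a⟩))
    (by
      rw [one_def, map_sum]
      simp only [lift_ofPath, Quiver.Path.weight_nil]
      ext i j
      simp [Matrix.sum_apply, Matrix.single_apply, Matrix.one_apply, ite_and])
    (fun y z => by
      induction y using induction with
      | h0 => simp
      | hadd y y' hy hy' => simp [add_mul, hy, hy']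
      | hpath b q =>
        rename_i j' l
        induction z using induction with
        | h0 => simp
        | hadd z z' hz hz' => simp only [map_add, mul_add, hz, hz']
        | hpath c p =>
          rename_i i j
          simp only [map_smul, smul_mul_assoc, mul_smul_comm, lift_ofPath]
          congr 2
          by_cases h : j = j'
          · subst h
            simp [ofPath_mul_ofPath, mul_comm]
          · rw [ofPath_mul_ofPath_of_ne h, map_zero, Matrix.single_mul_single_of_ne]
            exact fun h' => h h'.symm)

/-- The ideal `J` of the polynomial ring generated by the image `φ(I)`. -/
def relationIdeal (I : TwoSidedIdeal (PathAlgebra k V)) : Ideal (MvPolynomial (Arrow V) k) :=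
  Ideal.span {f | ∃ r : positivePart k V, (r : PathAlgebra k V) ∈ I ∧ pathMonomial k V r = f}

end PathAlgebra

end PathAlgebra

/-! ### Quotient stacks over a field -/

section QuotientStack

variable (k : Type u) [Field k]

/-- The category of `k`-schemes. -/
abbrev Sch : Type (u + 1) := Over (Spec (CommRingCat.of k))

variable {k}

/-- The ring of global functions of a `k`-scheme. -/
abbrev Fn (U : Sch k) : Type u := Γ(U.left, ⊤)

/-- Pullback of global functions. -/
def pull {U' U : Sch k} (h : U' ⟶ U) : Fn U →+* Fn U' := h.left.appTop.hom

@[simp] theorem pull_id (U : Sch k) : pull (𝟙 U) = RingHom.id (Fn U) := by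
  simp [pull]

theorem pull_comp {U'' U' U : Sch k} (g : U'' ⟶ U') (h : U' ⟶ U) :
    pull (g ≫ h) = (pull g).comp (pull h) := by
  change (g.left ≫ h.left).appTop.hom = _
  rw [Scheme.Hom.comp_appTop]
  rfl

/-- Pullback of invertible global functions. -/
def pullUnits {U' U : Sch k} (h : U' ⟶ U) : (Fn U)ˣ →* (Fn U')ˣ :=
  Units.map (pull h).toMonoidHom

theorem coe_pullUnits {U' U : Sch k} (h : U' ⟶ U) (c : (Fn U)ˣ) :
    (pullUnits h c : Fn U') = pull h (c : Fn U) := rfl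

theorem pullUnits_id (U : Sch k) (c : (Fn U)ˣ) : pullUnits (𝟙 U) c = c := by
  ext; simp [coe_pullUnits]

theorem pullUnits_comp {U'' U' U : Sch k} (g : U'' ⟶ U') (h : U' ⟶ U) (c : (Fn U)ˣ) :
    pullUnits (g ≫ h) c = pullUnits g (pullUnits h c) := by
  ext; simp [coe_pullUnits, pull_comp]

instance (U : Sch k) : Algebra k (Fn U) :=
  (U.hom.appTop.hom.comp (Scheme.ΓSpecIso (CommRingCat.of k)).inv.hom).toAlgebra

/-- A left action of a group presheaf `G` on a `k`-scheme `X`, given on `U`-valued points. -/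
structure Action (G : (Sch k)ᵒᵖ ⥤ GrpCat.{u}) (X : Sch k) where
  act : ∀ {U : Sch k}, G.obj (op U) → (U ⟶ X) → (U ⟶ X)
  one_act : ∀ {U : Sch k} (x : U ⟶ X), act 1 x = x
  mul_act : ∀ {U : Sch k} (g h : G.obj (op U)) (x : U ⟶ X), act (g * h) x = act g (act h x)
  comp_act : ∀ {U' U : Sch k} (h : U' ⟶ U) (g : G.obj (op U)) (x : U ⟶ X),
    h ≫ act g x = act (G.map h.op g) (h ≫ x)

/-- A `G`-torsor over the `k`-scheme `T`: a `T`-scheme `P` with an action of `G` over `T` which is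
simply transitive on the fibres of `P(U) → T(U)` for all `U`, and such that `P → T` has a section
étale locally on `T`. -/
structure Torsor (G : (Sch k)ᵒᵖ ⥤ GrpCat.{u}) (T : Sch k) where
  total : Sch k
  proj : total ⟶ T
  action : Action G total
  act_proj : ∀ {U : Sch k} (g : G.obj (op U)) (p : U ⟶ total), action.act g p ≫ proj = p ≫ proj
  simply_transitive : ∀ {U : Sch k} (p q : U ⟶ total), p ≫ proj = q ≫ proj →
    ∃! g : G.obj (op U), action.act g p = q
  locally_trivial : ∃ (T' : Sch k) (c : T' ⟶ T) (s : T' ⟶ total),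
    Etale c.left ∧ Surjective c.left ∧ s ≫ proj = c

/-- The quotient stack `[X / G]`, as a category fibred in groupoids over the category of
`k`-schemes. An object over `T` is a `G`-torsor over `T` with an equivariant morphism to `X`. -/
structure QuotientStack {G : (Sch k)ᵒᵖ ⥤ GrpCat.{u}} {X : Sch k} (A : Action G X) where
  base : Sch k
  torsor : Torsor G base
  map : torsor.total ⟶ X
  equivariant : ∀ {U : Sch k} (g : G.obj (op U)) (p : U ⟶ torsor.total),
    torsor.action.act g p ≫ map = A.act g (p ≫ map)

namespace QuotientStack

variable {G : (Sch k)ᵒᵖ ⥤ GrpCat.{u}} {X : Sch k} {A : Action G X}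

/-- A morphism in the quotient stack: a morphism of base schemes covered by an equivariant morphism
of torsors that commutes with the maps to `X`. -/
@[ext]
structure Hom (ξ η : QuotientStack A) where
  base : ξ.base ⟶ η.base
  total : ξ.torsor.total ⟶ η.torsor.total
  comm : total ≫ η.torsor.proj = ξ.torsor.proj ≫ base
  equivariant : ∀ {U : Sch k} (g : G.obj (op U)) (p : U ⟶ ξ.torsor.total),
    ξ.torsor.action.act g p ≫ total = η.torsor.action.act g (p ≫ total)
  map_eq : total ≫ η.map = ξ.map

instance : Category (QuotientStack A) where
  Hom := Hom
  id ξ := ⟨𝟙 _, 𝟙 _, by simp, by simp, by simp⟩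
  comp f g := ⟨f.base ≫ g.base, f.total ≫ g.total,
    by rw [Category.assoc, g.comm, ← Category.assoc, f.comm, Category.assoc],
    fun h p => by rw [← Category.assoc, f.equivariant, g.equivariant, Category.assoc],
    by rw [Category.assoc, g.map_eq, f.map_eq]⟩
  id_comp f := Hom.ext (Category.id_comp _) (Category.id_comp _)
  comp_id f := Hom.ext (Category.comp_id _) (Category.comp_id _)
  assoc f g h := Hom.ext (Category.assoc _ _ _) (Category.assoc _ _ _)

/-- The structure functor of the quotient stack to the category of `k`-schemes. -/
def toSch (A : Action G X) : QuotientStack A ⥤ Sch k where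
  obj ξ := ξ.base
  map f := f.base

end QuotientStack

end QuotientStack

/-! ### The moduli stack of representations of dimension vector `(1, …, 1)` -/

section Moduli

variable (k : Type u) [Field k] (n : Type u)

/-- The affine space with coordinates indexed by `n`, as a `k`-scheme. -/
def affine : Sch k := Over.mk (𝔸(n; Spec (CommRingCat.of k)) ↘ Spec (CommRingCat.of k))

variable {k n}

/-- The coordinates of a point of affine space. -/
def coords {U : Sch k} (x : U ⟶ affine k n) : n → Fn U :=
  fun a => x.left.appTop (AffineSpace.coord (Spec (CommRingCat.of k)) a)

/-- The point of affine space with given coordinates. -/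
def ofCoords {U : Sch k} (v : n → Fn U) : U ⟶ affine k n :=
  Over.homMk (AffineSpace.homOfVector U.hom v) (AffineSpace.homOfVector_over _ _)

@[simp] theorem coords_ofCoords {U : Sch k} (v : n → Fn U) : coords (ofCoords v) = v := by
  funext a
  exact AffineSpace.homOfVector_appTop_coord _ _ _

theorem affine_ext {U : Sch k} {x y : U ⟶ affine k n} (h : coords x = coords y) : x = y := by
  apply Over.OverMorphism.ext
  apply AffineSpace.hom_ext
  · exact (Over.w x).trans (Over.w y).symm
  · exact fun i => congrFun h i

theorem coords_comp {U' U : Sch k} (h : U' ⟶ U) (x : U ⟶ affine k n) (a : n) :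
    coords (h ≫ x) a = pull h (coords x a) := by
  change (h.left ≫ x.left).appTop _ = _
  rw [Scheme.Hom.comp_appTop]
  rfl

/-- The action of a group presheaf on affine space which scales each coordinate by a character. -/
def scalingAction (G : (Sch k)ᵒᵖ ⥤ GrpCat.{u}) (χ : ∀ U : Sch k, G.obj (op U) →* (n → (Fn U)ˣ))
    (hχ : ∀ {U' U : Sch k} (h : U' ⟶ U) (g : G.obj (op U)) (a : n),
      χ U' (G.map h.op g) a = pullUnits h (χ U g a)) : Action G (affine k n) where
  act {U} g x := ofCoords fun a => (χ U g a : Fn U) * coords x a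
  one_act x := affine_ext (by simp)
  mul_act g h x := affine_ext (by funext a; simp [mul_assoc])
  comp_act h g x := affine_ext (by funext a; simp [coords_comp, hχ, coe_pullUnits])

variable (k) (V : Type u)

/-- The group `∏_{v ∈ V} 𝔾_m` of base changes of the representations of dimension vector
`(1, …, 1)`. -/
def torus : (Sch k)ᵒᵖ ⥤ GrpCat.{u} where
  obj U := GrpCat.of (V → (Fn U.unop)ˣ)
  map h := GrpCat.ofHom ((pullUnits h.unop).compLeft V)
  map_id U := GrpCat.hom_ext (MonoidHom.ext fun g => funext fun v => pullUnits_id _ (g v))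
  map_comp f g := GrpCat.hom_ext (MonoidHom.ext fun x => funext fun v =>
    pullUnits_comp g.unop f.unop (x v))

/-- The subgroup of constant families, that is, the small diagonal `𝔾_m ⊆ ∏_{v ∈ V} 𝔾_m`. -/
def diagonal (U : Sch k) : Subgroup (V → (Fn U)ˣ) := (Pi.constMonoidHom V (Fn U)ˣ).range

/-- The group `PGL(Q; 1)`, the quotient of `∏_{v ∈ V} 𝔾_m` by the small diagonal. This quotient of
groups of points is already a sheaf, since the small diagonal is a direct factor for non-empty
`V`. -/
def projTorus : (Sch k)ᵒᵖ ⥤ GrpCat.{u} where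
  obj U := GrpCat.of ((V → (Fn U.unop)ˣ) ⧸ diagonal k V U.unop)
  map {U U'} h := GrpCat.ofHom (QuotientGroup.map _ (diagonal k V U'.unop)
    ((pullUnits h.unop).compLeft V) (by
      rintro _ ⟨c, rfl⟩
      exact ⟨pullUnits h.unop c, rfl⟩))
  map_id U := by
    refine GrpCat.hom_ext (MonoidHom.ext fun x => ?_)
    obtain ⟨x, rfl⟩ := QuotientGroup.mk_surjective x
    exact congrArg _ (funext fun v => pullUnits_id _ (x v))
  map_comp f g := by
    refine GrpCat.hom_ext (MonoidHom.ext fun x => ?_)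
    obtain ⟨x, rfl⟩ := QuotientGroup.mk_surjective x
    exact congrArg _ (funext fun v => pullUnits_comp g.unop f.unop (x v))

variable {k} [Quiver.{u} V]

/-- A family `g` of units, one for each vertex, scales the coordinate of the arrow `a : i ⟶ j` by
`g_j g_i⁻¹`. -/
def arrowCharacter (U : Sch k) : (V → (Fn U)ˣ) →* (Arrow V → (Fn U)ˣ) where
  toFun g a := g a.2.1 / g a.1
  map_one' := by funext a; simp
  map_mul' g h := by funext a; exact mul_div_mul_comm _ _ _ _

variable (k)

/-- The action of `∏_{v ∈ V} 𝔾_m` on the space of representations of dimension vector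
`(1, …, 1)`. -/
def torusAction : Action (torus k V) (affine k (Arrow V)) :=
  scalingAction _ (fun _ => arrowCharacter V _) (fun h g a => by
    exact (map_div (pullUnits h) (g a.2.1) (g a.1)).symm)

/-- The action of `PGL(Q; 1)` on the space of representations of dimension vector `(1, …, 1)`. -/
def projTorusAction : Action (projTorus k V) (affine k (Arrow V)) :=
  scalingAction _ (fun U : Sch k => QuotientGroup.lift (diagonal k V U) (arrowCharacter V U) (by
      rintro _ ⟨c, rfl⟩
      funext a
      exact div_self' c)) (fun h g a => by
    obtain ⟨g, rfl⟩ := QuotientGroup.mk_surjective g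
    exact (map_div (pullUnits h) (g a.2.1) (g a.1)).symm)

variable {k V} {G : (Sch k)ᵒᵖ ⥤ GrpCat.{u}}

/-- The substack `M(Q, I; 1)` of a quotient `[𝔸^{Q_1} / G]`, as a full subcategory: it consists of
the objects whose representation of the quiver is annihilated by all elements of `I`. -/
def relationSubstack [Fintype V] [DecidableEq V] (A : Action G (affine k (Arrow V)))
    (I : TwoSidedIdeal (PathAlgebra k V)) : ObjectProperty (QuotientStack A) :=
  fun ξ => ∀ r ∈ I, PathAlgebra.rep (coords ξ.map) r = 0

/-- The pullback of the polynomial function `f` on affine space to the torsor of an object of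
`[𝔸^n / G]`. -/
def pullPoly {n : Type u} {A : Action G (affine k n)} (ξ : QuotientStack A) :
    MvPolynomial n k →ₐ[k] Fn ξ.torsor.total := MvPolynomial.aeval (coords ξ.map)

/-- The closed subscheme `Spec (k[x]/J)` of affine space defined by an ideal `J`. -/
def zeroLocus {n : Type u} (J : Ideal (MvPolynomial n k)) : Sch k :=
  Over.mk ((Spec.map (CommRingCat.ofHom (Ideal.Quotient.mk J)) ≫
    (AffineSpace.SpecIso n (CommRingCat.of k)).inv) ≫ (affine k n).hom)

/-- The inclusion of the closed subscheme defined by an ideal `J`. -/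
def zeroLocusInclusion {n : Type u} (J : Ideal (MvPolynomial n k)) : zeroLocus J ⟶ affine k n :=
  Over.homMk (Spec.map (CommRingCat.ofHom (Ideal.Quotient.mk J)) ≫
    (AffineSpace.SpecIso n (CommRingCat.of k)).inv) rfl

theorem isClosedImmersion_zeroLocusInclusion {n : Type u} (J : Ideal (MvPolynomial n k)) :
    IsClosedImmersion (zeroLocusInclusion J).left := by
  have : IsClosedImmersion (Spec.map (CommRingCat.ofHom (Ideal.Quotient.mk J))) :=
    IsClosedImmersion.spec_of_surjective _ Ideal.Quotient.mk_surjective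
  exact (inferInstance : IsClosedImmersion
    (Spec.map (CommRingCat.ofHom (Ideal.Quotient.mk J)) ≫
      (AffineSpace.SpecIso n (CommRingCat.of k)).inv))

/-- The closed substack of `[𝔸^n / G]` cut out by an ideal `J`, as a full subcategory: it
consists of the objects for which the map from the torsor to affine space factors through the closed
subscheme defined by `J`. -/
def zeroSubstack {n : Type u} (A : Action G (affine k n)) (J : Ideal (MvPolynomial n k)) :
    ObjectProperty (QuotientStack A) :=
  fun ξ => ∃ g : ξ.torsor.total ⟶ zeroLocus J, g ≫ zeroLocusInclusion J = ξ.map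

variable (k V) in
/-- The degree of the variable of an arrow `a : i ⟶ j` is `e_j - e_i`. -/
def arrowDegree [DecidableEq V] (a : Arrow V) : V → ℤ := Pi.single a.2.1 1 - Pi.single a.1 1

/-- An ideal of the polynomial ring is homogeneous for the grading by `ℤ^V`: it contains all
homogeneous components of its elements. -/
def IsMultihomogeneous [DecidableEq V] (J : Ideal (MvPolynomial (Arrow V) k)) : Prop :=
  ∀ f ∈ J, ∀ d : V → ℤ, MvPolynomial.weightedHomogeneousComponent (arrowDegree V) d f ∈ J

end Moduli

end QuiverModuli

end

/-! Without oriented cycles, a path of positive length is determined by the set of its arrows,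
because the arrows can occur in only one order. More is true: if every arrow of `p` occurs in a path
`P`, then `P = w p v` for some paths `v`, `w` (`exists_eq_comp_comp`). So `φ` is injective on paths
of positive length and has a linear left inverse `pathPart`, which discards every monomial that does
not come from such a path.

The core is that `pathPart` maps `J` into `I` (`pathPart_mem`). Vertex idempotents reduce the
generators of `J` to `φ(s)` with `s ∈ I` a combination of parallel paths. For a monomial `m`, either
no term of `m φ(s)` comes from a path, or one factorisation `P = w p v` shows that `m` is the
monomial of `v` and `w` together, and then `pathPart (m φ(s)) = w s v ∈ I`
(`pathPart_monomial_mul_mem`). This gives `I = φ⁻¹(J)`. The same generators are homogeneous, since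
paths from `i` to `j` have degree `e_j - e_i`.

On the geometric side, a combination of parallel paths acts by a matrix with one possibly nonzero
entry, the value of `φ(s)`; hence annihilation by `I` means that the coordinates are zeros of `J`
(`forall_rep_eq_zero_iff`). To recover `J` from the substack it suffices to test one object: the
trivial torsor over `V(J)` with the map `(g, x) ↦ g · x`. Its restriction to the unit section is the
inclusion of `V(J)`, on which exactly the elements of `J` vanish. That torsor is a scheme because
both choices of `G` are represented by a power of `𝔾_m`. -/

noncomputable section

namespace QuiverModuli

/-! ### Paths in a quiver without oriented cycles and their monomials. -/

section Paths

variable {V : Type u} [Quiver.{u} V]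

/-- The exponent of the monomial of a path: the number of occurrences of each arrow. -/
def pathExponent {i j : V} (p : Quiver.Path i j) : Arrow V →₀ ℕ :=
  p.addWeight fun {i j : V} (a : i ⟶ j) => (Finsupp.single ⟨i, j, a⟩ 1 : Arrow V →₀ ℕ)

@[simp] theorem pathExponent_nil (i : V) : pathExponent (.nil : Quiver.Path i i) = 0 :=
  Quiver.Path.addWeight_nil _ _

@[simp] theorem pathExponent_cons {i j l : V} (p : Quiver.Path i j) (a : j ⟶ l) :
    pathExponent (p.cons a) = pathExponent p + Finsupp.single ⟨j, l, a⟩ 1 :=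
  Quiver.Path.addWeight_cons _ _ _

@[simp] theorem pathExponent_comp {i j l : V} (p : Quiver.Path i j) (q : Quiver.Path j l) :
    pathExponent (p.comp q) = pathExponent p + pathExponent q :=
  Quiver.Path.addWeight_comp _ _ _

theorem length_eq_zero_of_pathExponent_eq_zero {i j : V} (p : Quiver.Path i j)
    (h : pathExponent p = 0) : p.length = 0 := by
  cases p with
  | nil => rfl
  | cons p a =>
    rw [pathExponent_cons, add_eq_zero] at h
    simp at h

/-- A path that contains a given arrow splits at this arrow. -/
theorem exists_eq_cons_comp {i j l m : V} (p : Quiver.Path i j) (a : l ⟶ m)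
    (h : pathExponent p ⟨l, m, a⟩ ≠ 0) :
    ∃ (v : Quiver.Path i l) (u : Quiver.Path m j), p = (v.cons a).comp u := by
  classical
  induction p with
  | nil => simp at h
  | @cons j n p b ih =>
    by_cases hp : pathExponent p ⟨l, m, a⟩ = 0
    · rw [pathExponent_cons, Finsupp.add_apply, hp, zero_add, Finsupp.single_apply] at h
      have hab : (⟨j, n, b⟩ : Arrow V) = ⟨l, m, a⟩ := by
        by_contra hne
        exact h (if_neg hne)
      cases hab
      exact ⟨p, .nil, rfl⟩
    · obtain ⟨v, u, rfl⟩ := ih hp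
      exact ⟨v, u.cons b, rfl⟩

/-- In a quiver without oriented cycles, a path of positive length all of whose arrows occur in a
second path is a segment of the second path. -/
theorem exists_eq_comp_comp (hQ : NoOrientedCycles V) {i j i' j' : V} (P : Quiver.Path i j)
    (p : Quiver.Path i' j') (hp : 0 < p.length)
    (h : ∀ a, pathExponent p a ≠ 0 → pathExponent P a ≠ 0) :
    ∃ (v : Quiver.Path i i') (u : Quiver.Path j' j), P = (v.comp p).comp u := by
  induction p with
  | nil => simp at hp
  | @cons l m p a ih =>
    have ha : pathExponent P ⟨l, m, a⟩ ≠ 0 := h _ (by simp)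
    cases p with
    | nil =>
      obtain ⟨v, u, hP⟩ := exists_eq_cons_comp P a ha
      exact ⟨v, u, hP⟩
    | @cons n _ q b =>
      obtain ⟨v, u, rfl⟩ := ih (by simp) fun c hc => h c (by
        rw [pathExponent_cons, Finsupp.add_apply]
        omega)
      -- The arrow `a` must occur after the segment already found: an occurrence inside that segment
      -- or in `v` would close up to an oriented cycle.
      have hu : pathExponent u ⟨l, m, a⟩ ≠ 0 := by
        intro hu
        rw [pathExponent_comp, Finsupp.add_apply, hu, add_zero, pathExponent_comp,
          Finsupp.add_apply] at ha
        by_cases hv : pathExponent v ⟨l, m, a⟩ = 0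
        · rw [hv, zero_add] at ha
          obtain ⟨w, z, hw⟩ := exists_eq_cons_comp _ a ha
          have := hQ m (z.cons a)
          simp at this
        · obtain ⟨w, z, hw⟩ := exists_eq_cons_comp _ a hv
          have := hQ l ((((Quiver.Path.nil.cons a).comp z).comp (q.cons b)))
          simp at this
      obtain ⟨w, z, rfl⟩ := exists_eq_cons_comp _ a hu
      -- The piece of `u` before `a` is a closed path, hence trivial, so `a` follows the segment
      -- immediately.
      have hw := hQ l w
      obtain rfl := Quiver.Path.eq_nil_of_length_zero w hw
      exact ⟨v, z, by simp [← Quiver.Path.comp_assoc]⟩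

/-- In a quiver without oriented cycles, a path of positive length is determined by its monomial. -/
theorem eq_of_pathExponent_eq (hQ : NoOrientedCycles V) {P p : AnyPath V} (hp : 0 < p.2.2.length)
    (h : pathExponent P.2.2 = pathExponent p.2.2) : P = p := by
  obtain ⟨i, j, P⟩ := P
  obtain ⟨i', j', p⟩ := p
  obtain ⟨v, u, rfl⟩ := exists_eq_comp_comp hQ P p hp fun a ha => by
    simpa only [h] using ha
  have huv : pathExponent v + pathExponent u = 0 := by
    rw [pathExponent_comp, pathExponent_comp, add_right_comm] at h
    simpa using h
  rw [add_eq_zero] at huv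
  have hv := length_eq_zero_of_pathExponent_eq_zero v huv.1
  have hu := length_eq_zero_of_pathExponent_eq_zero u huv.2
  obtain rfl := Quiver.Path.eq_of_length_zero v hv
  obtain rfl := Quiver.Path.eq_of_length_zero u hu
  obtain rfl := Quiver.Path.eq_nil_of_length_zero v hv
  obtain rfl := Quiver.Path.eq_nil_of_length_zero u hu
  simp

end Paths

/-! ### Vertex idempotents and the positive part of the path algebra. -/

namespace PathAlgebra

variable (k : Type u) [Field k] {V : Type u} [Quiver.{u} V]

variable (V) in
/-- The linear map on the whole path algebra that sends a path to the product of its arrows. -/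
def monomialMap : PathAlgebra k V →ₗ[k] MvPolynomial (Arrow V) k :=
  lift k fun p : AnyPath V => MvPolynomial.monomial (pathExponent p.2.2) 1

theorem weight_X {i j : V} (p : Quiver.Path i j) :
    (p.weight fun {i j : V} (a : i ⟶ j) =>
      (MvPolynomial.X ⟨i, j, a⟩ : MvPolynomial (Arrow V) k)) =
      MvPolynomial.monomial (pathExponent p) 1 := by
  induction p with
  | nil => simp
  | cons p a ih =>
    rw [Quiver.Path.weight_cons, ih, pathExponent_cons, MvPolynomial.X, MvPolynomial.monomial_mul,
      mul_one]

theorem pathMonomial_apply [Fintype V] [DecidableEq V] (r : positivePart k V) :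
    pathMonomial k V r = monomialMap k V (r : PathAlgebra k V) := by
  simp only [pathMonomial, LinearMap.domRestrict_apply, monomialMap]
  congr 2
  funext p
  exact weight_X k p.2.2

@[simp] theorem monomialMap_ofPath {i j : V} (p : Quiver.Path i j) :
    monomialMap k V (ofPath k p) = MvPolynomial.monomial (pathExponent p) 1 :=
  lift_ofPath _ _

/-- The span of the paths of positive length from `i` to `j`. -/
def pathsBetween (i j : V) : Submodule k (PathAlgebra k V) :=
  Submodule.span k {x | ∃ p : Quiver.Path i j, 0 < p.length ∧ x = ofPath k p}

theorem pathsBetween_le [Fintype V] [DecidableEq V] (i j : V) : pathsBetween k i j ≤ positivePart k V :=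
  Submodule.span_mono fun _ ⟨p, hp, hx⟩ => ⟨i, j, p, hp, hx⟩

/-- The path of length zero at a vertex. -/
abbrev idem (i : V) : PathAlgebra k V := ofPath k (Quiver.Path.nil : Quiver.Path i i)

section Ring

variable [DecidableEq V]

variable {k} in
theorem mul_smul' (c : k) (x y : PathAlgebra k V) : x * (c • y) = c • (x * y) :=
  map_smul (mulMap k V x) c y

variable {k} in
theorem smul_mul' (c : k) (x y : PathAlgebra k V) : (c • x) * y = c • (x * y) :=
  LinearMap.map_smul₂ (mulMap k V) c x y

variable [Fintype V]

/-- Multiplication by the idempotents keeps exactly the terms that run from `i` to `j`. With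
`sum_idem_mul_mul_idem` this is the Peirce decomposition, which splits a relation into relations
between parallel paths without leaving the two-sided ideal. -/
theorem idem_mul_mul_idem_mem {r : PathAlgebra k V} (hr : r ∈ positivePart k V) (i j : V) :
    idem k j * r * idem k i ∈ pathsBetween k i j := by
  induction hr using Submodule.span_induction with
  | mem x hx =>
    obtain ⟨i', j', p, hp, rfl⟩ := hx
    by_cases hj : j' = j
    · subst hj
      by_cases hi : i = i'
      · subst hi
        rw [ofPath_mul_ofPath, ofPath_mul_ofPath]
        exact Submodule.subset_span ⟨p, hp, by simp⟩
      · rw [ofPath_mul_ofPath, ofPath_mul_ofPath_of_ne hi]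
        exact zero_mem _
    · rw [ofPath_mul_ofPath_of_ne hj, zero_mul]
      exact zero_mem _
  | zero => simp
  | add x y _ _ hx hy => simpa only [mul_add, add_mul] using add_mem hx hy
  | smul c x _ hx => simpa only [mul_smul', smul_mul'] using Submodule.smul_mem _ c hx

theorem sum_idem_mul_mul_idem (r : PathAlgebra k V) :
    ∑ j : V, ∑ i : V, idem k j * r * idem k i = r := by
  simp_rw [← Finset.mul_sum, ← Finset.sum_mul]
  rw [← one_def, mul_one, one_mul]

variable {k}

theorem mul_mul_mem (I : TwoSidedIdeal (PathAlgebra k V)) {r : PathAlgebra k V} (hr : r ∈ I)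
    (x y : PathAlgebra k V) : x * r * y ∈ I :=
  I.mul_mem_right _ _ (I.mul_mem_left _ _ hr)

/-- A two-sided ideal of the path algebra as a subspace. -/
def idealSubmodule (I : TwoSidedIdeal (PathAlgebra k V)) : Submodule k (PathAlgebra k V) where
  carrier := {x | x ∈ I}
  add_mem' := I.add_mem
  zero_mem' := I.zero_mem
  smul_mem' c x hx := by
    have h := I.mul_mem_left (c • 1) x hx
    rwa [smul_mul', one_mul] at h

/-- In the representation where all arrows act by zero, paths of positive length vanish, so the
diagonal entries read off the coefficients of the paths of length zero. -/
theorem sub_mem_positivePart (r : PathAlgebra k V) :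
    r - ∑ i, rep (R := k) (V := V) (0 : Arrow V → k) r i i • idem k i ∈ positivePart k V := by
  induction r using induction with
  | h0 => simp
  | hadd y z hy hz =>
    have : y + z - ∑ i, rep (R := k) (V := V) (0 : Arrow V → k) (y + z) i i • idem k i =
        (y - ∑ i, rep (R := k) (V := V) (0 : Arrow V → k) y i i • idem k i) +
        (z - ∑ i, rep (R := k) (V := V) (0 : Arrow V → k) z i i • idem k i) := by
      simp only [map_add, Matrix.add_apply, add_smul, Finset.sum_add_distrib]
      abel
    rw [this]
    exact add_mem hy hz
  | hpath c p =>
    rename_i i j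
    have hrep : rep (R := k) (V := V) (0 : Arrow V → k) (c • ofPath k p) =
        c • Matrix.single j i (p.weight fun {i j : V} (a : i ⟶ j) => (0 : k)) := by
      rw [map_smul]
      exact congrArg _ (lift_ofPath _ p)
    rw [hrep]
    cases p with
    | nil =>
      rw [Finset.sum_eq_single i]
      · simp
      · intro l _ hl
        simp [hl.symm]
      · simp
    | cons p a =>
      rw [Finset.sum_eq_zero]
      · rw [sub_zero]
        exact Submodule.smul_mem _ _ (Submodule.subset_span ⟨_, _, _, by simp, rfl⟩)
      · simp

/-- The zero representation kills the paths of length two, hence the ideal they generate, so the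
correction term in `sub_mem_positivePart` disappears. -/
theorem mem_positivePart_of_mem_lengthTwoIdeal {r : PathAlgebra k V}
    (hr : r ∈ lengthTwoIdeal k V) : r ∈ positivePart k V := by
  have hle : lengthTwoIdeal k V ≤ TwoSidedIdeal.ker (rep (R := k) (V := V) (0 : Arrow V → k)) := by
    refine TwoSidedIdeal.span_le.2 ?_
    rintro _ ⟨i, j, p, hp, rfl⟩
    refine (TwoSidedIdeal.mem_ker _).2 ((lift_ofPath _ p).trans ?_)
    cases p with
    | nil => simp at hp
    | cons p a => simp
  have h := sub_mem_positivePart r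
  rw [(TwoSidedIdeal.mem_ker _).1 (hle hr)] at h
  simpa using h

end Ring

end PathAlgebra

namespace PathAlgebra

variable {k : Type u} [Field k] {V : Type u} [Quiver.{u} V]

/-! ### A left inverse of `φ`, and the recovery of `I` from `J`. -/

section PathPart

variable (k V)

open Classical in
/-- The path of positive length with a given monomial, or zero if there is none. -/
def pathOfExponent (m : Arrow V →₀ ℕ) : PathAlgebra k V :=
  if h : ∃ p : AnyPath V, 0 < p.2.2.length ∧ pathExponent p.2.2 = m then ofPath k h.choose.2.2
  else 0

/-- The linear map on polynomials that sends the monomial of a path of positive length to the path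
and all other monomials to zero. -/
def pathPart : MvPolynomial (Arrow V) k →ₗ[k] PathAlgebra k V :=
  (MvPolynomial.basisMonomials (Arrow V) k).constr k (pathOfExponent k V)

variable {k V}

theorem pathPart_monomial (m : Arrow V →₀ ℕ) :
    pathPart k V (MvPolynomial.monomial m 1) = pathOfExponent k V m := by
  have h := (MvPolynomial.basisMonomials (Arrow V) k).constr_basis k (pathOfExponent k V) m
  rwa [MvPolynomial.coe_basisMonomials] at h

theorem pathOfExponent_pathExponent (hQ : NoOrientedCycles V) {i j : V} (p : Quiver.Path i j)
    (hp : 0 < p.length) : pathOfExponent k V (pathExponent p) = ofPath k p := by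
  have h : ∃ q : AnyPath V, 0 < q.2.2.length ∧ pathExponent q.2.2 = pathExponent p :=
    ⟨⟨i, j, p⟩, hp, rfl⟩
  rw [pathOfExponent, dif_pos h,
    eq_of_pathExponent_eq hQ (P := h.choose) (p := ⟨i, j, p⟩) hp h.choose_spec.2]

end PathPart

/-- The degrees of consecutive arrows telescope. -/
theorem weight_arrowDegree [DecidableEq V] {i j : V} (p : Quiver.Path i j) :
    Finsupp.weight (arrowDegree V) (pathExponent p) = Pi.single j 1 - Pi.single i 1 := by
  induction p with
  | nil => simp
  | cons p a ih =>
    rw [pathExponent_cons, map_add, ih, Finsupp.weight_single, one_smul, arrowDegree]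
    abel

variable [Fintype V] [DecidableEq V]

theorem pathPart_monomialMap (hQ : NoOrientedCycles V) {r : PathAlgebra k V}
    (hr : r ∈ positivePart k V) : pathPart k V (monomialMap k V r) = r := by
  induction hr using Submodule.span_induction with
  | mem x hx =>
    obtain ⟨i, j, p, hp, rfl⟩ := hx
    rw [monomialMap_ofPath, pathPart_monomial, pathOfExponent_pathExponent hQ p hp]
  | zero => simp
  | add x y _ _ hx hy => rw [map_add, map_add, hx, hy]
  | smul c x _ hx => rw [map_smul, map_smul, hx]

/-- One term of `m φ(s)` that comes from a path settles all terms: it forces `m` to be the monomial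
of a pair `v`, `w`, and every path `q` parallel to `p` then fits between `v` and `w`. -/
theorem pathPart_monomial_mul_mem (hQ : NoOrientedCycles V) (I : TwoSidedIdeal (PathAlgebra k V))
    {i j : V} {s : PathAlgebra k V} (hs : s ∈ pathsBetween k i j) (hsI : s ∈ I)
    (m : Arrow V →₀ ℕ) :
    pathPart k V (MvPolynomial.monomial m 1 * monomialMap k V s) ∈ I := by
  by_cases h : ∃ (p : Quiver.Path i j) (P : AnyPath V), 0 < p.length ∧
      m + pathExponent p = pathExponent P.2.2
  · obtain ⟨p, ⟨a, b, P⟩, hp, hP⟩ := h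
    dsimp only at hP
    obtain ⟨v, w, rfl⟩ := exists_eq_comp_comp hQ P p hp fun c hc => by
      rw [← hP, Finsupp.add_apply]
      omega
    have hm : m = pathExponent v + pathExponent w := by
      rw [pathExponent_comp, pathExponent_comp, add_right_comm] at hP
      exact add_right_cancel hP
    suffices H : pathPart k V (MvPolynomial.monomial m 1 * monomialMap k V s) =
        ofPath k w * s * ofPath k v by
      rw [H]
      exact mul_mul_mem I hsI _ _
    -- The identity is linear in `s` and is checked on single paths, which need not lie in `I`.
    clear hsI
    induction hs using Submodule.span_induction with
    | mem x hx =>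
      obtain ⟨q, hq, rfl⟩ := hx
      have hl : 0 < (v.comp (q.comp w)).length := by simp; omega
      rw [monomialMap_ofPath, MvPolynomial.monomial_mul, mul_one, pathPart_monomial,
        ofPath_mul_ofPath, ofPath_mul_ofPath, ← pathOfExponent_pathExponent hQ _ hl, hm]
      congr 1
      simp only [pathExponent_comp]
      abel
    | zero => simp
    | add x y _ _ hx hy => rw [map_add, mul_add, map_add, hx, hy, mul_add, add_mul]
    | smul c x _ hx =>
      rw [map_smul, mul_smul_comm, map_smul, hx, mul_smul', smul_mul']
  · suffices H : pathPart k V (MvPolynomial.monomial m 1 * monomialMap k V s) = 0 by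
      rw [H]
      exact I.zero_mem
    clear hsI
    induction hs using Submodule.span_induction with
    | mem x hx =>
      obtain ⟨q, hq, rfl⟩ := hx
      rw [monomialMap_ofPath, MvPolynomial.monomial_mul, mul_one, pathPart_monomial,
        pathOfExponent, dif_neg]
      rintro ⟨P, -, hP⟩
      exact h ⟨q, P, hq, hP.symm⟩
    | zero => simp
    | add x y _ _ hx hy => rw [map_add, mul_add, map_add, hx, hy, add_zero]
    | smul c x _ hx => rw [map_smul, mul_smul_comm, map_smul, hx, smul_zero]

theorem monomialMap_mem_relationIdeal {I : TwoSidedIdeal (PathAlgebra k V)} {r : PathAlgebra k V}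
    (hr : r ∈ positivePart k V) (hI : r ∈ I) : monomialMap k V r ∈ relationIdeal I :=
  Ideal.subset_span ⟨⟨r, hr⟩, hI, pathMonomial_apply k _⟩

/-- The ideal of relations is generated by the images of relations between paths with the same end
points. -/
theorem relationIdeal_eq_span (I : TwoSidedIdeal (PathAlgebra k V)) :
    relationIdeal I = Ideal.span {f | ∃ (i j : V) (s : PathAlgebra k V),
      s ∈ pathsBetween k i j ∧ s ∈ I ∧ monomialMap k V s = f} := by
  apply le_antisymm
  · refine Ideal.span_le.2 ?_
    rintro _ ⟨⟨r, hr⟩, hI, rfl⟩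
    rw [pathMonomial_apply]
    change monomialMap k V r ∈ _
    rw [← sum_idem_mul_mul_idem k r]
    simp only [map_sum]
    exact Ideal.sum_mem _ fun j _ => Ideal.sum_mem _ fun i _ => Ideal.subset_span
      ⟨i, j, _, idem_mul_mul_idem_mem k hr i j, mul_mul_mem I hI _ _, rfl⟩
  · refine Ideal.span_le.2 ?_
    rintro _ ⟨i, j, s, hs, hI, rfl⟩
    exact monomialMap_mem_relationIdeal (pathsBetween_le k i j hs) hI

theorem pathPart_mem (hQ : NoOrientedCycles V) (I : TwoSidedIdeal (PathAlgebra k V))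
    {f : MvPolynomial (Arrow V) k} (hf : f ∈ relationIdeal I) : pathPart k V f ∈ I := by
  rw [relationIdeal_eq_span] at hf
  -- `pathPart` is linear over `k` only, so the induction over the ideal needs all multiples of `f`
  -- at once.
  suffices H : ∀ g, pathPart k V (g * f) ∈ I by simpa using H 1
  induction hf using Submodule.span_induction with
  | mem x hx =>
    obtain ⟨i, j, s, hs, hI, rfl⟩ := hx
    intro g
    induction g using MvPolynomial.induction_on' with
    | monomial m c =>
      have hc : (MvPolynomial.monomial m c : MvPolynomial (Arrow V) k) =
          c • MvPolynomial.monomial m 1 := by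
        rw [MvPolynomial.smul_monomial, smul_eq_mul, mul_one]
      rw [hc, smul_mul_assoc, map_smul]
      exact (idealSubmodule I).smul_mem c (pathPart_monomial_mul_mem hQ I hs hI m)
    | add p q hp hq =>
      rw [add_mul, map_add]
      exact I.add_mem hp hq
  | zero =>
    intro g
    rw [mul_zero, map_zero]
    exact I.zero_mem
  | add x y _ _ hx hy =>
    intro g
    rw [mul_add, map_add]
    exact I.add_mem (hx g) (hy g)
  | smul a x _ hx =>
    intro g
    rw [smul_eq_mul, ← mul_assoc]
    exact hx _

/-- The ideal of relations is recovered from the ideal of the polynomial ring. -/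
theorem mem_iff_pathMonomial_mem (hQ : NoOrientedCycles V) {I : TwoSidedIdeal (PathAlgebra k V)}
    (hI : I ≤ lengthTwoIdeal k V) (r : PathAlgebra k V) :
    r ∈ I ↔ ∃ h : r ∈ positivePart k V, pathMonomial k V ⟨r, h⟩ ∈ relationIdeal I := by
  constructor
  · intro hr
    have hp := mem_positivePart_of_mem_lengthTwoIdeal (hI hr)
    refine ⟨hp, ?_⟩
    rw [pathMonomial_apply]
    exact monomialMap_mem_relationIdeal hp hr
  · rintro ⟨hp, hr⟩
    rw [pathMonomial_apply] at hr
    simpa only [pathPart_monomialMap hQ hp] using pathPart_mem hQ I hr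

theorem isWeightedHomogeneous_monomialMap {i j : V} {s : PathAlgebra k V}
    (hs : s ∈ pathsBetween k i j) :
    MvPolynomial.IsWeightedHomogeneous (arrowDegree V) (monomialMap k V s)
      (Pi.single j 1 - Pi.single i 1) := by
  rw [← MvPolynomial.mem_weightedHomogeneousSubmodule]
  induction hs using Submodule.span_induction with
  | mem x hx =>
    obtain ⟨q, hq, rfl⟩ := hx
    rw [monomialMap_ofPath]
    exact MvPolynomial.isWeightedHomogeneous_monomial _ _ _ (weight_arrowDegree q)
  | zero =>
    rw [map_zero]
    exact zero_mem _
  | add x y _ _ hx hy =>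
    rw [map_add]
    exact add_mem hx hy
  | smul c x _ hx =>
    rw [map_smul]
    exact Submodule.smul_mem _ c hx

theorem isMultihomogeneous_relationIdeal (I : TwoSidedIdeal (PathAlgebra k V)) :
    IsMultihomogeneous (relationIdeal I) := by
  intro f hf d
  let _ := MvPolynomial.weightedGradedAlgebra k (arrowDegree V)
  have h : (relationIdeal I).IsHomogeneous
      (MvPolynomial.weightedHomogeneousSubmodule k (arrowDegree V)) := by
    rw [relationIdeal_eq_span]
    refine Ideal.homogeneous_span _ _ ?_
    rintro _ ⟨i, j, s, hs, -, rfl⟩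
    exact ⟨_, isWeightedHomogeneous_monomialMap hs⟩
  exact (MvPolynomial.mem_iff_weightedHomogeneousComponent_mem k _ h f).1 hf d

/-! ### Representations annihilated by `I` as zeros of `J`. -/

section Rep

variable {R : Type*} [CommRing R] [Algebra k R] (x : Arrow V → R)

theorem rep_ofPath_eq_weight {i j : V} (p : Quiver.Path i j) :
    rep x (ofPath k p) =
      Matrix.single j i (p.weight fun {i j : V} (a : i ⟶ j) => x ⟨i, j, a⟩) :=
  lift_ofPath (k := k) _ p

theorem rep_ofPath {i j : V} (p : Quiver.Path i j) :
    rep x (ofPath k p) = Matrix.single j i (MvPolynomial.aeval x (monomialMap k V (ofPath k p))) := by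
  rw [rep_ofPath_eq_weight, monomialMap_ofPath]
  congr 1
  induction p with
  | nil => simp
  | cons p a ih =>
    rw [Quiver.Path.weight_cons, ih, pathExponent_cons, MvPolynomial.monomial_add_single, map_mul,
      pow_one, MvPolynomial.aeval_X]

theorem rep_of_mem_pathsBetween {i j : V} {s : PathAlgebra k V} (hs : s ∈ pathsBetween k i j) :
    rep x s = Matrix.single j i (MvPolynomial.aeval x (monomialMap k V s)) := by
  induction hs using Submodule.span_induction with
  | mem y hy =>
    obtain ⟨q, hq, rfl⟩ := hy
    exact rep_ofPath x q
  | zero => simp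
  | add y z _ _ hy hz => rw [map_add, map_add, map_add, Matrix.single_add, hy, hz]
  | smul c y _ hy => rw [map_smul, map_smul, map_smul, hy, Matrix.smul_single]

/-- A representation is annihilated by the relations if and only if the coordinates are zeros of
the ideal of relations. -/
theorem forall_rep_eq_zero_iff {I : TwoSidedIdeal (PathAlgebra k V)}
    (hI : I ≤ lengthTwoIdeal k V) :
    (∀ r ∈ I, rep x r = 0) ↔ ∀ f ∈ relationIdeal I, MvPolynomial.aeval x f = 0 := by
  constructor
  · intro h
    suffices H : relationIdeal I ≤ RingHom.ker (MvPolynomial.aeval (R := k) x) from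
      fun f hf => H hf
    rw [relationIdeal_eq_span]
    refine Ideal.span_le.2 ?_
    rintro _ ⟨i, j, s, hs, hsI, rfl⟩
    have h0 := h s hsI
    rw [rep_of_mem_pathsBetween x hs] at h0
    simpa using congrFun (congrFun h0 j) i
  · intro h r hr
    rw [← sum_idem_mul_mul_idem k r]
    simp only [map_sum]
    refine Finset.sum_eq_zero fun j _ => Finset.sum_eq_zero fun i _ => ?_
    have hm := idem_mul_mul_idem_mem k (mem_positivePart_of_mem_lengthTwoIdeal (hI hr)) i j
    rw [rep_of_mem_pathsBetween x hm, h _ (monomialMap_mem_relationIdeal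
      (pathsBetween_le k i j hm) (mul_mul_mem I hr _ _)), Matrix.single_zero]

/-- A change of basis multiplies the entries of the matrices of a representation by units. -/
theorem rep_scale (g : V → Rˣ) (r : PathAlgebra k V) (i j : V) :
    rep (fun a : Arrow V => ((g a.2.1 / g a.1 : Rˣ) : R) * x a) r j i =
      ((g j / g i : Rˣ) : R) * rep x r j i := by
  induction r using induction with
  | h0 => simp
  | hadd y z hy hz => simp only [map_add, Matrix.add_apply, hy, hz, mul_add]
  | hpath c p =>
    rename_i i' j'
    rw [map_smul, map_smul, Matrix.smul_apply, Matrix.smul_apply, mul_smul_comm]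
    congr 1
    have hp : (p.weight fun {i j : V} (a : i ⟶ j) => ((g j / g i : Rˣ) : R) * x ⟨i, j, a⟩) =
        ((g j' / g i' : Rˣ) : R) * p.weight fun {i j : V} (a : i ⟶ j) => x ⟨i, j, a⟩ := by
      induction p with
      | nil => simp
      | @cons b c p a ih =>
        -- The scaling factors telescope along the path.
        rw [Quiver.Path.weight_cons, ih, Quiver.Path.weight_cons,
          ← div_mul_div_cancel (g c) (g b) (g i'), Units.val_mul]
        ring
    rw [rep_ofPath_eq_weight, rep_ofPath_eq_weight, hp, Matrix.single_apply, Matrix.single_apply]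
    split_ifs with h
    · obtain ⟨rfl, rfl⟩ := h
      rfl
    · simp

theorem rep_scale_eq_zero (g : V → Rˣ) {r : PathAlgebra k V} (hr : rep x r = 0) :
    rep (fun a : Arrow V => ((g a.2.1 / g a.1 : Rˣ) : R) * x a) r = 0 := by
  ext j i
  rw [rep_scale, hr]
  simp

end Rep

end PathAlgebra

/-! ### Points of the closed subscheme `V(J)`. -/

section ZeroLocus

variable {k : Type u} [Field k] {n : Type u}

theorem algebraMap_eq (U : Sch k) : algebraMap k (Fn U) =
    U.hom.appTop.hom.comp (Scheme.ΓSpecIso (CommRingCat.of k)).inv.hom := rfl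

theorem pull_algebraMap {U' U : Sch k} (h : U' ⟶ U) (c : k) :
    pull h (algebraMap k (Fn U) c) = algebraMap k (Fn U') c := by
  rw [algebraMap_eq, algebraMap_eq, ← Over.w h, Scheme.Hom.comp_appTop]
  rfl

theorem aeval_coords_comp {U' U : Sch k} (h : U' ⟶ U) (x : U ⟶ affine k n)
    (f : MvPolynomial n k) :
    MvPolynomial.aeval (coords (h ≫ x)) f = pull h (MvPolynomial.aeval (coords x) f) := by
  have hc : coords (h ≫ x) = fun a => pull h (coords x a) := funext (coords_comp h x)
  rw [hc]
  induction f using MvPolynomial.induction_on with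
  | C c =>
    rw [MvPolynomial.aeval_C, MvPolynomial.aeval_C, pull_algebraMap]
  | add p q hp hq => rw [map_add, map_add, map_add, hp, hq]
  | mul_X p a hp =>
    rw [map_mul, map_mul, map_mul, hp, MvPolynomial.aeval_X, MvPolynomial.aeval_X]

theorem toSpecΓ_comp_SpecMap_appTop {X : Scheme.{u}} {R : Type u} [CommRing R]
    (φ : R →+* Γ(X, ⊤)) (r : R) :
    (X.toSpecΓ ≫ Spec.map (CommRingCat.ofHom φ)).appTop
      ((Scheme.ΓSpecIso (CommRingCat.of R)).inv r) = φ r := by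
  have h : (Scheme.ΓSpecIso (CommRingCat.of R)).inv ≫
      (X.toSpecΓ ≫ Spec.map (CommRingCat.ofHom φ)).appTop = CommRingCat.ofHom φ := by
    rw [Scheme.Hom.comp_appTop, ← Scheme.ΓSpecIso_inv_naturality_assoc, Scheme.toSpecΓ_appTop,
      Iso.inv_hom_id, Category.comp_id]
  exact congrArg (fun g => g.hom r) h

theorem toSpecΓ_comp_SpecMap_algebraMap (U : Sch k) :
    U.left.toSpecΓ ≫ Spec.map (CommRingCat.ofHom (algebraMap k (Fn U))) = U.hom := by
  have h : CommRingCat.ofHom (algebraMap k (Fn U)) =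
      (Scheme.ΓSpecIso (CommRingCat.of k)).inv ≫ U.hom.appTop := rfl
  rw [h, Spec.map_comp, ← Scheme.toSpecΓ_naturality_assoc]
  erw [toSpecΓ_SpecMap_ΓSpecIso_inv]
  exact Category.comp_id _

theorem zeroLocus_hom (J : Ideal (MvPolynomial n k)) : (zeroLocus J).hom =
    Spec.map (CommRingCat.ofHom ((Ideal.Quotient.mk J).comp MvPolynomial.C)) := by
  change (Spec.map (CommRingCat.ofHom (Ideal.Quotient.mk J)) ≫
    (AffineSpace.SpecIso n (CommRingCat.of k)).inv) ≫
      (𝔸(n; Spec (CommRingCat.of k)) ↘ Spec (CommRingCat.of k)) = _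
  rw [Category.assoc, AffineSpace.SpecIso_inv_over, ← Spec.map_comp]
  rfl

theorem coords_zeroLocusInclusion (J : Ideal (MvPolynomial n k)) (a : n) :
    coords (zeroLocusInclusion J) a =
      (Scheme.ΓSpecIso (CommRingCat.of (MvPolynomial n k ⧸ J))).inv
        (Ideal.Quotient.mk J (MvPolynomial.X a)) := by
  change (Spec.map (CommRingCat.ofHom (Ideal.Quotient.mk J)) ≫
    (AffineSpace.SpecIso n (CommRingCat.of k)).inv).appTop
      (AffineSpace.coord (Spec (CommRingCat.of k)) a) = _
  rw [Scheme.Hom.comp_appTop, CommRingCat.comp_apply, AffineSpace.SpecIso_inv_appTop_coord]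
  exact congrArg (fun g => g.hom (MvPolynomial.X a))
    (Scheme.ΓSpecIso_inv_naturality (CommRingCat.ofHom (Ideal.Quotient.mk J))).symm

theorem aeval_coords_zeroLocusInclusion (J : Ideal (MvPolynomial n k)) (f : MvPolynomial n k) :
    MvPolynomial.aeval (coords (zeroLocusInclusion J)) f =
      (Scheme.ΓSpecIso (CommRingCat.of (MvPolynomial n k ⧸ J))).inv (Ideal.Quotient.mk J f) := by
  induction f using MvPolynomial.induction_on with
  | C c =>
    rw [MvPolynomial.aeval_C, algebraMap_eq, zeroLocus_hom]
    exact congrArg (fun g => g.hom c) (Scheme.ΓSpecIso_inv_naturality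
      (CommRingCat.ofHom ((Ideal.Quotient.mk J).comp MvPolynomial.C))).symm
  | add p q hp hq =>
    rw [map_add, map_add, map_add, hp, hq]
    rfl
  | mul_X p a hp =>
    rw [map_mul, map_mul, map_mul, hp, MvPolynomial.aeval_X, coords_zeroLocusInclusion]
    rfl

/-- Evaluation at the inclusion is the quotient map to `S/J`, because an affine scheme has its ring
as global functions. So this single point detects membership in `J`. -/
theorem aeval_coords_zeroLocusInclusion_eq_zero_iff (J : Ideal (MvPolynomial n k))
    (f : MvPolynomial n k) :
    MvPolynomial.aeval (coords (zeroLocusInclusion J)) f = 0 ↔ f ∈ J := by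
  rw [aeval_coords_zeroLocusInclusion, ← Ideal.Quotient.eq_zero_iff_mem]
  exact map_eq_zero_iff _
    (Scheme.ΓSpecIso (CommRingCat.of (MvPolynomial n k ⧸ J))).symm.commRingCatIsoToRingEquiv.injective

/-- The points of the closed subscheme defined by `J` are the points of affine space whose
coordinates are zeros of `J`. -/
theorem exists_comp_zeroLocusInclusion_iff {U : Sch k} (x : U ⟶ affine k n)
    (J : Ideal (MvPolynomial n k)) :
    (∃ g : U ⟶ zeroLocus J, g ≫ zeroLocusInclusion J = x) ↔
      ∀ f ∈ J, MvPolynomial.aeval (coords x) f = 0 := by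
  constructor
  · rintro ⟨g, rfl⟩ f hf
    rw [aeval_coords_comp, (aeval_coords_zeroLocusInclusion_eq_zero_iff J f).2 hf, map_zero]
  · intro h
    let φ : MvPolynomial n k ⧸ J →+* Fn U :=
      Ideal.Quotient.lift J (MvPolynomial.aeval (coords x)).toRingHom h
    have hφ : φ.comp ((Ideal.Quotient.mk J).comp MvPolynomial.C) = algebraMap k (Fn U) :=
      RingHom.ext fun c => MvPolynomial.aeval_C _ c
    have hU : U.left.toSpecΓ ≫ Spec.map (CommRingCat.ofHom φ) ≫
        Spec.map (CommRingCat.ofHom ((Ideal.Quotient.mk J).comp MvPolynomial.C)) = U.hom := by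
      rw [← Spec.map_comp, ← CommRingCat.ofHom_comp, hφ]
      exact toSpecΓ_comp_SpecMap_algebraMap U
    -- The factorisation is the morphism to the affine scheme `Spec (S/J)` that corresponds to the
    -- ring map `φ`.
    refine ⟨Over.homMk (U.left.toSpecΓ ≫ Spec.map (CommRingCat.ofHom φ)) ?_, ?_⟩
    · rw [zeroLocus_hom]
      exact (Category.assoc _ _ _).trans hU
    · refine affine_ext (funext fun a => ?_)
      rw [coords_comp, coords_zeroLocusInclusion]
      exact (toSpecΓ_comp_SpecMap_appTop φ _).trans (MvPolynomial.aeval_X _ a)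

theorem zeroLocusInclusion_cancel {U : Sch k} {J : Ideal (MvPolynomial n k)}
    {g h : U ⟶ zeroLocus J}
    (hgh : g ≫ zeroLocusInclusion J = h ≫ zeroLocusInclusion J) : g = h := by
  have := isClosedImmersion_zeroLocusInclusion J
  apply Over.OverMorphism.ext
  exact (cancel_mono (zeroLocusInclusion J).left).1 (congrArg (fun f => f.left) hgh)

end ZeroLocus

/-! ### Trivial torsors and the objects of the stack given by points of `X`. -/

section TrivialTorsor

open Limits

variable {k : Type u} [Field k] {G : (Sch k)ᵒᵖ ⥤ GrpCat.{u}} {Y : Sch k}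

/-- The trivial torsor of a group presheaf that is represented by a scheme. -/
def trivialTorsor (e : (G ⋙ forget GrpCat).RepresentableBy Y) (T : Sch k) : Torsor G T where
  total := Y ⨯ T
  proj := prod.snd
  action :=
    { act := fun g p => prod.lift (e.homEquiv.symm (g * e.homEquiv (p ≫ prod.fst))) (p ≫ prod.snd)
      one_act := fun p => by
        refine Limits.prod.hom_ext ?_ ?_
        · rw [prod.lift_fst, one_mul, Equiv.symm_apply_apply]
        · rw [prod.lift_snd]
      mul_act := fun g h p => by
        refine Limits.prod.hom_ext ?_ ?_
        · rw [prod.lift_fst, prod.lift_fst, prod.lift_fst, Equiv.apply_symm_apply, mul_assoc]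
        · rw [prod.lift_snd, prod.lift_snd, prod.lift_snd]
      comp_act := fun h g p => by
        refine Limits.prod.hom_ext ?_ ?_
        · rw [Category.assoc, prod.lift_fst, prod.lift_fst, e.comp_homEquiv_symm, Category.assoc,
            e.homEquiv_comp h]
          exact congrArg _ (map_mul (G.map h.op).hom _ _)
        · rw [Category.assoc, prod.lift_snd, prod.lift_snd, Category.assoc] }
  act_proj g p := prod.lift_snd _ _
  simply_transitive {U} p q hpq := by
    refine ⟨e.homEquiv (q ≫ prod.fst) * (e.homEquiv (p ≫ prod.fst))⁻¹, ?_, fun g hg => ?_⟩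
    · refine Limits.prod.hom_ext ?_ ?_
      · rw [prod.lift_fst, inv_mul_cancel_right, Equiv.symm_apply_apply]
      · rw [prod.lift_snd]
        exact hpq
    · rw [eq_mul_inv_iff_mul_eq, ← hg, prod.lift_fst, Equiv.apply_symm_apply]
  locally_trivial := ⟨T, 𝟙 T, prod.lift (e.homEquiv.symm 1) (𝟙 T),
    by rw [Over.id_left]; infer_instance, by rw [Over.id_left]; infer_instance, prod.lift_snd _ _⟩

/-- The object of the quotient stack given by a point of the scheme. -/
def ofPoint {X : Sch k} (A : Action G X) (e : (G ⋙ forget GrpCat).RepresentableBy Y) {T : Sch k}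
    (x : T ⟶ X) : QuotientStack A where
  base := T
  torsor := trivialTorsor e T
  map := A.act (U := Y ⨯ T) (e.homEquiv prod.fst) (prod.snd ≫ x)
  equivariant {U} g p := by
    -- On points the map is `(g, t) ↦ g · x(t)`, so equivariance reduces to associativity of the
    -- action.
    have h : ∀ q : U ⟶ Y ⨯ T, q ≫ A.act (U := Y ⨯ T) (e.homEquiv prod.fst) (prod.snd ≫ x) =
        A.act (e.homEquiv (q ≫ prod.fst)) ((q ≫ prod.snd) ≫ x) := fun q => by
      rw [A.comp_act, e.homEquiv_comp, Category.assoc]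
      rfl
    refine (h _).trans (Eq.trans ?_ (congrArg _ (h p)).symm)
    rw [← A.mul_act]
    dsimp only [trivialTorsor]
    rw [prod.lift_fst, prod.lift_snd, Equiv.apply_symm_apply]

/-- The section is the unit of the group, where `(g, t) ↦ g · x(t)` restricts to `x`. A function
whose pullback to the torsor vanishes therefore vanishes at `x`. -/
theorem exists_comp_ofPoint_map {X : Sch k} (A : Action G X)
    (e : (G ⋙ forget GrpCat).RepresentableBy Y) {T : Sch k} (x : T ⟶ X) :
    ∃ s : T ⟶ (ofPoint A e x).torsor.total, s ≫ (ofPoint A e x).map = x := by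
  refine ⟨prod.lift (e.homEquiv.symm (1 : G.obj (op T))) (𝟙 T), ?_⟩
  refine (A.comp_act _ _ _).trans ?_
  have hx : prod.lift (e.homEquiv.symm (1 : G.obj (op T))) (𝟙 T) ≫ prod.snd ≫ x = x := by
    rw [← Category.assoc, prod.lift_snd, Category.id_comp]
  have h : G.map (prod.lift (e.homEquiv.symm (1 : G.obj (op T))) (𝟙 T)).op
      (e.homEquiv (prod.fst : Y ⨯ T ⟶ Y)) = 1 := by
    refine (e.homEquiv_comp _ _).symm.trans ?_
    rw [prod.lift_fst, Equiv.apply_symm_apply]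
  exact (congrArg₂ A.act h hx).trans (A.one_act x)

end TrivialTorsor

/-! ### Both groups are represented by powers of `𝔾_m`. -/

section Units

variable (k : Type u) [Field k] (W : Type u)

/-- The ideal generated by the polynomials `x_w y_w - 1`. -/
def unitsIdeal : Ideal (MvPolynomial (W ⊕ W) k) :=
  Ideal.span (Set.range fun w : W => MvPolynomial.X (Sum.inl w) * MvPolynomial.X (Sum.inr w) - 1)

/-- The scheme `𝔾_m^W`. -/
abbrev unitsScheme : Sch k := zeroLocus (unitsIdeal k W)

variable {k W}

theorem forall_mem_unitsIdeal_iff {R : Type*} [CommRing R] [Algebra k R] (x : W ⊕ W → R) :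
    (∀ f ∈ unitsIdeal k W, MvPolynomial.aeval x f = 0) ↔
      ∀ w, x (Sum.inl w) * x (Sum.inr w) = 1 := by
  have h : (∀ f ∈ unitsIdeal k W, MvPolynomial.aeval x f = 0) ↔
      unitsIdeal k W ≤ RingHom.ker (MvPolynomial.aeval (R := k) x) := Iff.rfl
  rw [h, unitsIdeal, Ideal.span_le, Set.range_subset_iff]
  refine forall_congr' fun w => ?_
  rw [SetLike.mem_coe, RingHom.mem_ker]
  simp [sub_eq_zero]

/-- The coordinates of a point of `𝔾_m^W` as units. -/
def toUnits {U : Sch k} (p : U ⟶ unitsScheme k W) (w : W) : (Fn U)ˣ :=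
  have h := (forall_mem_unitsIdeal_iff _).1
    ((exists_comp_zeroLocusInclusion_iff _ _).1 ⟨p, rfl⟩) w
  { val := coords (p ≫ zeroLocusInclusion (unitsIdeal k W)) (Sum.inl w)
    inv := coords (p ≫ zeroLocusInclusion (unitsIdeal k W)) (Sum.inr w)
    val_inv := h
    inv_val := (mul_comm _ _).trans h }

theorem toUnits_comp {U' U : Sch k} (h : U' ⟶ U) (p : U ⟶ unitsScheme k W) (w : W) :
    toUnits (h ≫ p) w = pullUnits h (toUnits p w) := by
  ext
  rw [coe_pullUnits]
  change coords ((h ≫ p) ≫ _) _ = pull h (coords (p ≫ _) _)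
  rw [Category.assoc, coords_comp]

theorem toUnits_bijective (U : Sch k) :
    Function.Bijective (toUnits : (U ⟶ unitsScheme k W) → W → (Fn U)ˣ) := by
  constructor
  · intro p q hpq
    refine zeroLocusInclusion_cancel (affine_ext (funext fun a => ?_))
    cases a with
    | inl w => exact congrArg Units.val (congrFun hpq w)
    | inr w => exact congrArg (fun c : (Fn U)ˣ => (c⁻¹ : (Fn U)ˣ).val) (congrFun hpq w)
  · intro c
    let x : U ⟶ affine k (W ⊕ W) :=
      ofCoords (Sum.elim (fun w => (c w : Fn U)) fun w => ((c w)⁻¹ : (Fn U)ˣ))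
    obtain ⟨p, hp⟩ := (exists_comp_zeroLocusInclusion_iff x (unitsIdeal k W)).2
      ((forall_mem_unitsIdeal_iff _).2 fun w => by simp [x])
    refine ⟨p, funext fun w => Units.ext ?_⟩
    change coords (p ≫ _) _ = _
    rw [hp]
    simp [x]

/-- A group presheaf whose points are families of units is represented by `𝔾_m^W`. -/
def representableByUnits {G : (Sch k)ᵒᵖ ⥤ GrpCat.{u}}
    (e : ∀ U : Sch k, G.obj (op U) ≃ (W → (Fn U)ˣ))
    (he : ∀ {U' U : Sch k} (h : U' ⟶ U) (g : G.obj (op U)) (w : W),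
      e U' (G.map h.op g) w = pullUnits h (e U g w)) :
    (G ⋙ forget GrpCat).RepresentableBy (unitsScheme k W) where
  homEquiv {U} := (Equiv.ofBijective _ (toUnits_bijective U)).trans (e U).symm
  homEquiv_comp {U' U} h p := by
    refine (e U').injective (funext fun w => ?_)
    refine Eq.trans ?_ (he h _ w).symm
    simp [toUnits_comp]

variable (k) (V : Type u)

theorem exists_representableBy_torus :
    ∃ Y : Sch k, Nonempty ((torus k V ⋙ forget GrpCat).RepresentableBy Y) :=
  ⟨unitsScheme k V, ⟨representableByUnits (fun _ => Equiv.refl _) fun _ _ _ => rfl⟩⟩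

open Classical in
/-- After the choice of a vertex `v₀`, the quotient of the torus by the small diagonal is
identified with the families of units indexed by the other vertices. -/
def quotientDiagonalEquiv (v₀ : V) (U : Sch k) :
    ((V → (Fn U)ˣ) ⧸ diagonal k V U) ≃ ({v : V // v ≠ v₀} → (Fn U)ˣ) where
  toFun := QuotientGroup.lift (diagonal k V U)
    { toFun := fun g w => g w.1 / g v₀
      map_one' := by funext w; simp
      map_mul' := fun g h => by funext w; exact mul_div_mul_comm _ _ _ _ } (by
        rintro _ ⟨c, rfl⟩
        funext w
        exact div_self' c)
  invFun c := QuotientGroup.mk fun v => if h : v ≠ v₀ then c ⟨v, h⟩ else 1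
  left_inv g := by
    obtain ⟨g, rfl⟩ := QuotientGroup.mk_surjective g
    -- The representative is normalised to be `1` at `v₀`; it differs from `g` by the constant `g
    -- v₀`.
    refine QuotientGroup.eq.2 ⟨g v₀, funext fun v => ?_⟩
    by_cases h : v = v₀
    · simp [h]
    · simp [h]
  right_inv c := by
    funext w
    simp [w.2]

theorem exists_representableBy_projTorus :
    ∃ Y : Sch k, Nonempty ((projTorus k V ⋙ forget GrpCat).RepresentableBy Y) := by
  -- Without vertices there is no `v₀` to normalise at, but both groups are then trivial.
  rcases isEmpty_or_nonempty V with hV | ⟨⟨v₀⟩⟩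
  · refine ⟨unitsScheme k V, ⟨representableByUnits (fun U => ?_) fun _ _ w => hV.elim w⟩⟩
    exact
      { toFun := fun _ => 1
        invFun := fun _ => 1
        left_inv := fun g => by
          obtain ⟨g, rfl⟩ := QuotientGroup.mk_surjective g
          exact congrArg _ (funext fun w => hV.elim w)
        right_inv := fun _ => funext fun w => hV.elim w }
  · refine ⟨unitsScheme k {v : V // v ≠ v₀},
      ⟨representableByUnits (fun U => quotientDiagonalEquiv k V v₀ U) fun h g w => ?_⟩⟩
    obtain ⟨g, rfl⟩ := QuotientGroup.mk_surjective g
    exact (map_div (pullUnits h) (g w.1) (g v₀)).symm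

end Units

/-! ### The substack determines `J`, and `J` determines `I`. -/

section Substack

open PathAlgebra

variable {k : Type u} [Field k] {V : Type u} [Quiver.{u} V]

theorem torusAction_coords {U : Sch k} (g : (torus k V).obj (op U))
    (x : U ⟶ affine k (Arrow V)) : ∃ c : V → (Fn U)ˣ, coords ((torusAction k V).act g x) =
      fun a => ((c a.2.1 / c a.1 : (Fn U)ˣ) : Fn U) * coords x a :=
  ⟨g, coords_ofCoords _⟩

theorem projTorusAction_coords {U : Sch k} (g : (projTorus k V).obj (op U))
    (x : U ⟶ affine k (Arrow V)) : ∃ c : V → (Fn U)ˣ, coords ((projTorusAction k V).act g x) =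
      fun a => ((c a.2.1 / c a.1 : (Fn U)ˣ) : Fn U) * coords x a := by
  obtain ⟨g, rfl⟩ := QuotientGroup.mk_surjective g
  exact ⟨g, coords_ofCoords _⟩

variable [Fintype V] [DecidableEq V] {G : (Sch k)ᵒᵖ ⥤ GrpCat.{u}} {A : Action G (affine k (Arrow V))}

theorem relationSubstack_eq_zeroSubstack {I : TwoSidedIdeal (PathAlgebra k V)}
    (hI : I ≤ lengthTwoIdeal k V) :
    relationSubstack A I = zeroSubstack A (relationIdeal I) := by
  funext ξ
  exact propext ((forall_rep_eq_zero_iff _ hI).trans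
    (exists_comp_zeroLocusInclusion_iff _ _).symm)

/-- The ideal of relations is the ideal of the functions that vanish on the substack. -/
theorem mem_relationIdeal_iff
    (hA : ∀ {U : Sch k} (g : G.obj (op U)) (x : U ⟶ affine k (Arrow V)), ∃ c : V → (Fn U)ˣ,
      coords (A.act g x) = fun a => ((c a.2.1 / c a.1 : (Fn U)ˣ) : Fn U) * coords x a)
    (hG : ∃ Y : Sch k, Nonempty ((G ⋙ forget GrpCat).RepresentableBy Y))
    {I : TwoSidedIdeal (PathAlgebra k V)} (hI : I ≤ lengthTwoIdeal k V)
    (f : MvPolynomial (Arrow V) k) :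
    f ∈ relationIdeal I ↔ ∀ ξ, relationSubstack A I ξ → pullPoly ξ f = 0 := by
  constructor
  · intro hf ξ hξ
    exact (forall_rep_eq_zero_iff _ hI).1 hξ f hf
  · intro h
    obtain ⟨Y, ⟨e⟩⟩ := hG
    -- The universal zero of `J` gives the test object.
    let x := zeroLocusInclusion (relationIdeal I)
    obtain ⟨s, hs⟩ := exists_comp_ofPoint_map A e x
    rw [← aeval_coords_zeroLocusInclusion_eq_zero_iff]
    refine (congrArg (fun y => MvPolynomial.aeval (coords y) f) hs).symm.trans ?_
    refine (aeval_coords_comp s _ f).trans ?_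
    refine (congrArg (pull s) (h (ofPoint A e x) fun r hr => ?_)).trans (map_zero _)
    -- The test object lies in the substack: its map is the universal zero moved by a group element,
    -- and such rescaling preserves annihilation by `I`.
    obtain ⟨c, hc⟩ := hA (e.homEquiv Limits.prod.fst) ((Limits.prod.snd : Limits.prod Y _ ⟶ _) ≫ x)
    refine (congrArg (fun y => rep y r) hc).trans (rep_scale_eq_zero _ c ?_)
    exact (forall_rep_eq_zero_iff _ hI).2
      ((exists_comp_zeroLocusInclusion_iff _ _).1 ⟨_, rfl⟩) r hr

theorem ideal_eq_of_relationIdeal_eq (hQ : NoOrientedCycles V)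
    {I I' : TwoSidedIdeal (PathAlgebra k V)} (hI : I ≤ lengthTwoIdeal k V)
    (hI' : I' ≤ lengthTwoIdeal k V) (h : relationIdeal I = relationIdeal I') : I = I' :=
  SetLike.ext fun r => by
    rw [mem_iff_pathMonomial_mem hQ hI, mem_iff_pathMonomial_mem hQ hI', h]

end Substack

end QuiverModuli

end

/-- Let `Q` be a finite quiver without oriented cycles, and let `[𝔸^{Q_1} / G]` be the moduli stack
of its representations of dimension vector `(1, …, 1)`, where `G` is `∏_{v ∈ Q_0} 𝔾_m` or its
quotient `PGL(Q; 1)` by the small diagonal. A two-sided ideal `I ⊆ (kQ)_{≥ 2}` is determined by the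
closed substack `M(Q, I; 1)`: the homogeneous ideal `J = (φ(I))` is the ideal of this substack, and
`I = φ⁻¹(J)`. -/
theorem mainTheorem10 {k : Type u} [Field k] {V : Type u} [Quiver.{u} V] [Fintype V]
    [DecidableEq V] [∀ i j : V, Finite (i ⟶ j)] (hQ : QuiverModuli.NoOrientedCycles V) :
    (∀ I I' : TwoSidedIdeal (QuiverModuli.PathAlgebra k V),
      I ≤ QuiverModuli.PathAlgebra.lengthTwoIdeal k V →
      I' ≤ QuiverModuli.PathAlgebra.lengthTwoIdeal k V →
      (QuiverModuli.relationSubstack (QuiverModuli.torusAction k V) I =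
          QuiverModuli.relationSubstack (QuiverModuli.torusAction k V) I' → I = I') ∧
      (QuiverModuli.relationSubstack (QuiverModuli.projTorusAction k V) I =
          QuiverModuli.relationSubstack (QuiverModuli.projTorusAction k V) I' → I = I')) ∧
    ∀ I : TwoSidedIdeal (QuiverModuli.PathAlgebra k V),
      I ≤ QuiverModuli.PathAlgebra.lengthTwoIdeal k V →
      QuiverModuli.IsMultihomogeneous (QuiverModuli.PathAlgebra.relationIdeal I) ∧
      (QuiverModuli.relationSubstack (QuiverModuli.torusAction k V) I =
          QuiverModuli.zeroSubstack (QuiverModuli.torusAction k V)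
            (QuiverModuli.PathAlgebra.relationIdeal I) ∧
        QuiverModuli.relationSubstack (QuiverModuli.projTorusAction k V) I =
          QuiverModuli.zeroSubstack (QuiverModuli.projTorusAction k V)
            (QuiverModuli.PathAlgebra.relationIdeal I)) ∧
      (∀ f : MvPolynomial (QuiverModuli.Arrow V) k,
        (f ∈ QuiverModuli.PathAlgebra.relationIdeal I ↔
          ∀ ξ, QuiverModuli.relationSubstack (QuiverModuli.torusAction k V) I ξ →
            QuiverModuli.pullPoly ξ f = 0) ∧
        (f ∈ QuiverModuli.PathAlgebra.relationIdeal I ↔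
          ∀ ξ, QuiverModuli.relationSubstack (QuiverModuli.projTorusAction k V) I ξ →
            QuiverModuli.pullPoly ξ f = 0)) ∧
      (∀ r : QuiverModuli.PathAlgebra k V, r ∈ I ↔
        ∃ h : r ∈ QuiverModuli.PathAlgebra.positivePart k V,
          QuiverModuli.PathAlgebra.pathMonomial k V ⟨r, h⟩ ∈
            QuiverModuli.PathAlgebra.relationIdeal I)
      := by
  have ht : ∀ I : TwoSidedIdeal (QuiverModuli.PathAlgebra k V),
      I ≤ QuiverModuli.PathAlgebra.lengthTwoIdeal k V → _ := fun I hI =>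
    QuiverModuli.mem_relationIdeal_iff (A := QuiverModuli.torusAction k V)
      QuiverModuli.torusAction_coords (QuiverModuli.exists_representableBy_torus k V) hI
  have hp : ∀ I : TwoSidedIdeal (QuiverModuli.PathAlgebra k V),
      I ≤ QuiverModuli.PathAlgebra.lengthTwoIdeal k V → _ := fun I hI =>
    QuiverModuli.mem_relationIdeal_iff (A := QuiverModuli.projTorusAction k V)
      QuiverModuli.projTorusAction_coords (QuiverModuli.exists_representableBy_projTorus k V) hI
  refine ⟨fun I I' hI hI' => ⟨fun h => ?_, fun h => ?_⟩, fun I hI =>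
    ⟨QuiverModuli.PathAlgebra.isMultihomogeneous_relationIdeal I,
      ⟨QuiverModuli.relationSubstack_eq_zeroSubstack hI,
        QuiverModuli.relationSubstack_eq_zeroSubstack hI⟩,
      fun f => ⟨ht I hI f, hp I hI f⟩,
      QuiverModuli.PathAlgebra.mem_iff_pathMonomial_mem hQ hI⟩⟩
  · refine QuiverModuli.ideal_eq_of_relationIdeal_eq hQ hI hI' (Ideal.ext fun f => ?_)
    rw [ht I hI, ht I' hI', h]
  · refine QuiverModuli.ideal_eq_of_relationIdeal_eq hQ hI hI' (Ideal.ext fun f => ?_)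
    rw [hp I hI, hp I' hI', h]
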